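/- Let $\mathrm{FI}$ be the category whose objects are the finite sets $[n]=\{1,\dots,n\}$, $n\ge 0$ (with $[0]=\emptyset$), and whose morphisms are all injections. Let $\mathbf{Graph}$ be the category of finite simple graphs (no loops, no multiple edges, not necessarily connected), whose morphisms are maps of vertices that send edges to edges. An $\mathrm{FI}$-graph is a functor $G_\bullet:\mathrm{FI}\to\mathbf{Graph}$; write $G_n$ for its value at $[n]$ and $G(f)$ for the morphism induced by an injection $f$. For an integer $d\ge 0$, the $\mathrm{FI}$-graph $G_\bullet$ is vertex-stable with stable degree $\le d$ if for every $n\ge d$ and every vertex $v\in V(G_{n+1})$ there are a vertex $w\in V(G_n)$ and an injection $f:[n]\hookrightarrow[n+1]$ with $G(f)(w)=v$. **Theorem.** Let $G_\bullet$ be a vertex-stable $\mathrm{FI}$-graph of stable degree $\le d$. Then there are polynomials $p,q\in\mathbb{Q}[x]$, each of degree at most $d$, such that for all sufficiently large $n$ $$\Delta(G_n)=p(n)\qquad\text{and}\qquad \delta(G_n)=q(n),$$ where $\Delta(G)$ and $\delta(G)$ denote the maximum and the minimum degree of a vertex of $G$ (both taken to be $0$ if $G$ has no vertices). -/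

import Mathlib

open CategoryTheory Filter Polynomial

universe u

/-- The category `FI`. The object `⟨n⟩` stands for the `n`-element set `[n]`, realized as `Fin n`;
the empty set `[0]` is an object. -/
@[ext]
structure FI : Type where
  card : ℕ

namespace FI

/-- The morphisms of `FI` are all the injections. -/
instance : Category FI where
  Hom a b := Fin a.card ↪ Fin b.card
  id a := Function.Embedding.refl (Fin a.card)
  comp f g := Function.Embedding.trans f g

/-- An injection `[m] ↪ [n]`, seen as a morphism of `FI`. -/
def ofEmbedding {m n : ℕ} (f : Fin m ↪ Fin n) : (FI.mk m) ⟶ (FI.mk n) := f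

end FI

/-- Finite simple graphs (no loops, no multiple edges; possibly disconnected or empty). -/
structure FinSimpleGraph : Type (u + 1) where
  V : Type u
  [fintypeV : Fintype V]
  graph : SimpleGraph V

namespace FinSimpleGraph

attribute [instance] FinSimpleGraph.fintypeV

/-- Morphisms are graph homomorphisms: maps of vertices that send edges to edges. -/
instance : Category.{u} FinSimpleGraph.{u} where
  Hom G H := G.graph →g H.graph
  id _ := SimpleGraph.Hom.id
  comp f g := SimpleGraph.Hom.comp g f

/-- The map on vertices that underlies a morphism of graphs. -/
def onVertices {G H : FinSimpleGraph.{u}} (φ : G ⟶ H) : G.V → H.V :=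
  fun v => (show G.graph →g H.graph from φ) v

open Classical in
/-- The maximum degree `Δ(G)` (equal to `0` if `G` has no vertex). -/
noncomputable def maxDeg (G : FinSimpleGraph.{u}) : ℕ := G.graph.maxDegree

open Classical in
/-- The minimum degree `δ(G)` (equal to `0` if `G` has no vertex). -/
noncomputable def minDeg (G : FinSimpleGraph.{u}) : ℕ := G.graph.minDegree

end FinSimpleGraph

/-- An `FI`-graph is a functor from `FI` to the category of finite simple graphs. -/
abbrev FIGraph : Type (u + 1) := FI ⥤ FinSimpleGraph.{u}

namespace FIGraph

/-- The graph `G_n`, the value of `G` at `[n]`. -/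
abbrev at_ (G : FIGraph.{u}) (n : ℕ) : FinSimpleGraph.{u} := G.obj (FI.mk n)

/-- The map `V(G_m) → V(G_n)` that the transition map of an injection `[m] ↪ [n]` induces. -/
def transition (G : FIGraph.{u}) {m n : ℕ} (f : Fin m ↪ Fin n) : (G.at_ m).V → (G.at_ n).V :=
  FinSimpleGraph.onVertices (G.map (FI.ofEmbedding f))

/-- `G` is vertex-stable with stable degree `≤ d`: for all `n ≥ d`, every vertex of `G_{n+1}` is
the image of a vertex of `G_n` under the transition map of some injection `[n] ↪ [n+1]`. -/
def VertexStable (G : FIGraph.{u}) (d : ℕ) : Prop :=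
  ∀ n : ℕ, d ≤ n → ∀ v : (G.at_ (n + 1)).V,
    ∃ (w : (G.at_ n).V) (f : Fin n ↪ Fin (n + 1)), G.transition f w = v

end FIGraph

/-! For `n ≥ d` stability writes each vertex of `G_n` as `f_* w` with `w` in the finite set `V(G_d)`
and `f : [d] ↪ [n]`. A pair `(f, h)` is determined up to injections of `[n]` by its overlap, so
adjacency, or equality, of `f_* w` and `h_* w'` eventually depends on the overlap alone, and the
number of such `h` is a polynomial in `n` independent of `f` (`exists_polynomial_card_rel`).
Counting neighbors of `f_* w` through pairs `(w', h)`, each weighted by the inverse of its fiber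
size, gives a rational function of `n`. Its values are integers, so it is eventually a polynomial
(`exists_eventually_eq_eval`), of degree at most `d` because `G_n` has `O(n^d)` vertices. Finitely
many polynomials are eventually ordered, so one of them is the maximum and one the minimum. -/

/-! ### Pairs of injections and their overlaps -/

/-- The pairs of indices at which two injections agree. -/
def overlap {d n : ℕ} (f h : Fin d ↪ Fin n) : Set (Fin d × Fin d) := {p | f p.1 = h p.2}

theorem overlap_trans {d n m : ℕ} (f h : Fin d ↪ Fin n) (g : Fin n ↪ Fin m) :
    overlap (f.trans g) (h.trans g) = overlap f h := by
  ext p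
  simp [overlap]

/-- Equal overlaps make `f i ↦ f' i`, `h j ↦ h' j` a well-defined injection on the union of the two
images; since `n ≤ m` it extends to all of `Fin n`. -/
theorem exists_embedding_of_overlap_eq {d n m : ℕ} (hnm : n ≤ m) {f h : Fin d ↪ Fin n}
    {f' h' : Fin d ↪ Fin m} (H : overlap f h = overlap f' h') :
    ∃ g : Fin n ↪ Fin m, f.trans g = f' ∧ h.trans g = h' := by
  classical
  have H' : ∀ i j, f i = h j ↔ f' i = h' j := fun i j => by
    simpa [overlap] using Set.ext_iff.1 H (i, j)
  let s : Fin d ⊕ Fin d → Fin n := Sum.elim f h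
  let s' : Fin d ⊕ Fin d → Fin m := Sum.elim f' h'
  have key : ∀ a b, s a = s b ↔ s' a = s' b := by
    rintro (i | i) (j | j)
    · simp [s, s']
    · simpa [s, s'] using H' i j
    · simpa [s, s', eq_comm] using H' j i
    · simp [s, s']
  let g₀ : Fin n → Fin m := Function.extend s s' (Fin.castLE hnm)
  have hg₀ : ∀ a, g₀ (s a) = s' a := fun a =>
    Function.FactorsThrough.extend_apply (fun a b hab => (key a b).1 hab) _ a
  let S : Finset (Fin n) := Finset.univ.image s
  have hinj : Set.InjOn g₀ S := by
    intro x hx y hy hxy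
    obtain ⟨a, -, rfl⟩ := Finset.mem_image.1 (Finset.mem_coe.1 hx)
    obtain ⟨b, -, rfl⟩ := Finset.mem_image.1 (Finset.mem_coe.1 hy)
    rw [hg₀, hg₀] at hxy
    exact (key a b).2 hxy
  have hcard : (S.image g₀).card ≤ n :=
    Finset.card_image_le.trans (by simpa using S.card_le_univ)
  obtain ⟨t, ht, -, htn⟩ := Finset.exists_subsuperset_card_eq (Finset.subset_univ (S.image g₀))
    hcard (by simpa using hnm)
  obtain ⟨e, he⟩ := Finset.exists_equiv_extend_of_card_eq
    (by simpa using htn.symm : Fintype.card (Fin n) = t.card) ht hinj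
  have he' : ∀ a, (e (s a) : Fin m) = s' a := fun a => by
    rw [he _ (Finset.mem_image_of_mem _ (Finset.mem_univ a)), hg₀]
  refine ⟨e.toEmbedding.trans (Function.Embedding.subtype _), ?_, ?_⟩
  · ext1 i
    exact he' (Sum.inl i)
  · ext1 i
    exact he' (Sum.inr i)

/-- A relation on injections that is preserved by postcomposition eventually depends only on
the overlap. -/
theorem exists_eventually_iff_overlap_mem {d : ℕ}
    (P : ∀ n, (Fin d ↪ Fin n) → (Fin d ↪ Fin n) → Prop)
    (hP : ∀ n m (f h : Fin d ↪ Fin n) (g : Fin n ↪ Fin m), P n f h → P m (f.trans g) (h.trans g)) :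
    ∃ T : Set (Set (Fin d × Fin d)), ∀ᶠ n in atTop, ∀ f h, P n f h ↔ overlap f h ∈ T := by
  -- The overlaps at which `P` holds at some stage; there are finitely many, so one threshold serves
  -- all.
  refine ⟨{σ | ∃ n f h, P n f h ∧ overlap f h = σ}, ?_⟩
  have : ∀ σ : Set (Fin d × Fin d), ∀ᶠ n in atTop, ∀ f h : Fin d ↪ Fin n, overlap f h = σ →
      (∃ k f h, P k f h ∧ overlap f h = σ) → P n f h := by
    intro σ
    by_cases hσ : ∃ k f h, P k f h ∧ overlap f h = σ
    · obtain ⟨k, f₀, h₀, hk, rfl⟩ := hσ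
      filter_upwards [eventually_ge_atTop k] with n hn f h hfh _
      obtain ⟨g, rfl, rfl⟩ := exists_embedding_of_overlap_eq hn hfh.symm
      exact hP _ _ _ _ _ hk
    · exact Eventually.of_forall fun n f h _ h' => (hσ h').elim
  filter_upwards [eventually_all.2 this] with n hn f h
  exact ⟨fun hfh => ⟨n, f, h, hfh, rfl⟩, hn _ f h rfl⟩

/-- The overlap forces `h` at the indices it matches with `f`; the other indices are sent by an
arbitrary injection into the complement of the range of `f`. -/
theorem card_overlap_eq {d n : ℕ} (f h₀ : Fin d ↪ Fin n) :
    Nat.card {h : Fin d ↪ Fin n // overlap f h = overlap f h₀} =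
      (n - d).descFactorial (Nat.card {j // ∀ i, (i, j) ∉ overlap f h₀}) := by
  classical
  let C := {j // ∀ i, (i, j) ∉ overlap f h₀}
  let R := {k : Fin n // k ∉ Set.range f}
  let F : {h : Fin d ↪ Fin n // overlap f h = overlap f h₀} → (C ↪ R) := fun h =>
    ⟨fun j => ⟨h.1 j.1, by
      rintro ⟨i, hi⟩
      exact j.2 i (h.2.subset hi)⟩, fun j k hjk => Subtype.ext (h.1.injective (congrArg Subtype.val hjk))⟩
  have hF : Function.Bijective F := by
    constructor
    · intro h k hhk
      ext1
      ext1 j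
      by_cases hj : ∀ i, (i, j) ∉ overlap f h₀
      · exact congrArg Subtype.val (DFunLike.congr_fun hhk ⟨j, hj⟩)
      · push Not at hj
        obtain ⟨i, hi⟩ := hj
        have h1 : f i = h.1 j := h.2.symm.subset hi
        have h2 : f i = k.1 j := k.2.symm.subset hi
        rw [← h1, ← h2]
    · intro e
      let g : Fin d → Fin n := fun j => if hj : ∀ i, (i, j) ∉ overlap f h₀ then (e ⟨j, hj⟩).1 else h₀ j
      have hg1 : ∀ j (hj : ∀ i, (i, j) ∉ overlap f h₀), g j = (e ⟨j, hj⟩).1 := fun j hj => dif_pos hj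
      have hg2 : ∀ j, (¬ ∀ i, (i, j) ∉ overlap f h₀) → g j = h₀ j ∧ g j ∈ Set.range f := by
        intro j hj
        have : g j = h₀ j := dif_neg hj
        push Not at hj
        obtain ⟨i, hi⟩ := hj
        exact ⟨this, i, this.symm ▸ hi⟩
      have hgi : Function.Injective g := by
        intro j k hjk
        by_cases hj : ∀ i, (i, j) ∉ overlap f h₀ <;> by_cases hk : ∀ i, (i, k) ∉ overlap f h₀
        · rw [hg1 j hj, hg1 k hk] at hjk
          exact congrArg Subtype.val (e.injective (Subtype.ext hjk))
        · exact absurd (hg2 k hk).2 (hjk ▸ hg1 j hj ▸ (e ⟨j, hj⟩).2)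
        · exact absurd (hg2 j hj).2 (hjk ▸ hg1 k hk ▸ (e ⟨k, hk⟩).2)
        · rw [(hg2 j hj).1, (hg2 k hk).1] at hjk
          exact h₀.injective hjk
      refine ⟨⟨⟨g, hgi⟩, ?_⟩, ?_⟩
      · ext ⟨i, j⟩
        change f i = g j ↔ _
        by_cases hj : ∀ i, (i, j) ∉ overlap f h₀
        · exact iff_of_false (fun h => (e ⟨j, hj⟩).2 ⟨i, h.trans (hg1 j hj)⟩) (hj i)
        · rw [(hg2 j hj).1]
          rfl
      · ext1 j
        exact Subtype.ext (hg1 j.1 j.2)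
  have hR : Fintype.card R = n - d := by
    have h1 : Fintype.card {k : Fin n // k ∈ Set.range f} = d := by
      rw [← Nat.card_eq_fintype_card]
      exact (Nat.card_range_of_injective f.injective).trans (by simp)
    have h2 := Fintype.card_subtype_compl (fun k : Fin n => k ∈ Set.range f)
    rw [h1, Fintype.card_fin] at h2
    exact h2
  rw [Nat.card_congr (Equiv.ofBijective F hF), Nat.card_eq_fintype_card, Fintype.card_embedding_eq,
    hR, Nat.card_eq_fintype_card]

theorem exists_polynomial_card_overlap_eq {d : ℕ} (σ : Set (Fin d × Fin d)) :
    ∃ a : ℚ[X], ∀ᶠ n in atTop, ∀ f : Fin d ↪ Fin n,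
      (Nat.card {h : Fin d ↪ Fin n // overlap f h = σ} : ℚ) = a.eval (n : ℚ) := by
  by_cases hσ : ∃ k, ∃ f₀ h₀ : Fin d ↪ Fin k, overlap f₀ h₀ = σ
  · obtain ⟨k, f₀, h₀, rfl⟩ := hσ
    refine ⟨(descPochhammer ℚ (Nat.card {j // ∀ i, (i, j) ∉ overlap f₀ h₀})).comp (X - C (d : ℚ)), ?_⟩
    filter_upwards [eventually_ge_atTop k, eventually_ge_atTop d] with n hn hdn f
    -- An injection overlaps itself in the diagonal, so every `f` factors as `f₀` followed by some
    -- `g`.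
    obtain ⟨g, rfl, -⟩ := exists_embedding_of_overlap_eq hn
      (f := f₀) (h := f₀) (f' := f) (h' := f) (by ext p; simp [overlap])
    rw [← overlap_trans f₀ h₀ g, card_overlap_eq, eval_comp, eval_sub, eval_X, eval_C,
      ← Nat.cast_sub hdn, descPochhammer_eval_eq_descFactorial]
  · refine ⟨0, Eventually.of_forall fun n f => ?_⟩
    have : IsEmpty {h : Fin d ↪ Fin n // overlap f h = σ} := ⟨fun h => hσ ⟨n, f, h.1, h.2⟩⟩
    simp

theorem exists_polynomial_card_overlap_mem {d : ℕ} (T : Set (Set (Fin d × Fin d))) :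
    ∃ a : ℚ[X], ∀ᶠ n in atTop, ∀ f : Fin d ↪ Fin n,
      (Nat.card {h : Fin d ↪ Fin n // overlap f h ∈ T} : ℚ) = a.eval (n : ℚ) := by
  classical
  choose a ha using fun σ : Set (Fin d × Fin d) => exists_polynomial_card_overlap_eq σ
  refine ⟨∑ σ : T, a σ, ?_⟩
  filter_upwards [eventually_all.2 ha] with n hn f
  let e : {h : Fin d ↪ Fin n // overlap f h ∈ T} ≃ Σ σ : T, {h : Fin d ↪ Fin n // overlap f h = σ} :=
    { toFun := fun h => ⟨⟨_, h.2⟩, h.1, rfl⟩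
      invFun := fun x => ⟨x.2.1, x.2.2.symm ▸ x.1.2⟩
      left_inv := fun _ => rfl
      right_inv := by rintro ⟨⟨σ, hσ⟩, h, hh⟩; cases hh; rfl }
  rw [Nat.card_congr e, Nat.card_sigma, Nat.cast_sum, eval_finsetSum]
  exact Finset.sum_congr rfl fun σ _ => hn σ f

/-! ### Polynomials at large integers -/

theorem Polynomial.eventually_eval_le_or_ge (p q : ℚ[X]) :
    (∀ᶠ n : ℕ in atTop, p.eval (n : ℚ) ≤ q.eval (n : ℚ)) ∨
      ∀ᶠ n : ℕ in atTop, q.eval (n : ℚ) ≤ p.eval (n : ℚ) := by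
  have key : ∀ r : ℚ[X], 0 ≤ r.leadingCoeff → ∀ᶠ n : ℕ in atTop, 0 ≤ r.eval (n : ℚ) := by
    intro r hr
    refine tendsto_natCast_atTop_atTop.eventually (p := fun x : ℚ => 0 ≤ r.eval x) ?_
    rcases le_or_gt r.degree 0 with h | h
    · rw [eq_C_of_degree_le_zero h] at hr ⊢
      exact Eventually.of_forall fun x => by simpa using hr
    · exact (r.tendsto_atTop_of_leadingCoeff_nonneg h hr).eventually_ge_atTop 0
  rcases le_total 0 (q - p).leadingCoeff with h | h
  · exact Or.inl ((key _ h).mono fun n hn => by simpa using hn)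
  · refine Or.inr ((key (-(q - p)) (by rw [leadingCoeff_neg]; exact neg_nonneg.2 h)).mono fun n hn => ?_)
    simpa using hn

theorem Polynomial.exists_eventually_eval_max {ι : Type*} [Finite ι] [Nonempty ι] (p : ι → ℚ[X]) :
    ∃ i, ∀ᶠ n : ℕ in atTop, ∀ j, (p j).eval (n : ℚ) ≤ (p i).eval (n : ℚ) := by
  let r : ι → ι → Prop := fun i j => ∀ᶠ n : ℕ in atTop, (p i).eval (n : ℚ) ≤ (p j).eval (n : ℚ)
  have : IsTrans ι r := ⟨fun i j k hij hjk => by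
    filter_upwards [hij, hjk] with n h1 h2 using h1.trans h2⟩
  have hr : Directed r (id : ι → ι) := fun i j => by
    rcases eventually_eval_le_or_ge (p i) (p j) with h | h
    · exact ⟨j, h, Eventually.of_forall fun _ => le_rfl⟩
    · exact ⟨i, Eventually.of_forall fun _ => le_rfl, h⟩
  obtain ⟨i, hi⟩ := hr.finite_le id
  exact ⟨i, eventually_all.2 hi⟩

theorem Polynomial.exists_eventually_eval_min {ι : Type*} [Finite ι] [Nonempty ι] (p : ι → ℚ[X]) :
    ∃ i, ∀ᶠ n : ℕ in atTop, ∀ j, (p i).eval (n : ℚ) ≤ (p j).eval (n : ℚ) := by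
  obtain ⟨i, hi⟩ := exists_eventually_eval_max fun i => -p i
  exact ⟨i, hi.mono fun n hn j => by simpa using hn j⟩

theorem Polynomial.exists_natCast_mul_eval_int (p : ℚ[X]) :
    ∃ k : ℤ, k ≠ 0 ∧ ∀ n : ℕ, ∃ z : ℤ, (k : ℚ) * p.eval (n : ℚ) = z := by
  obtain ⟨b, hb, hp⟩ := IsLocalization.integerNormalization_spec (nonZeroDivisors ℤ) p
  refine ⟨b, nonZeroDivisors.ne_zero hb, fun n => ?_⟩
  have h := congrArg (eval (n : ℚ)) hp
  rw [eval_smul, zsmul_eq_mul] at h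
  refine ⟨(IsLocalization.integerNormalization (nonZeroDivisors ℤ) p).eval (n : ℤ), ?_⟩
  rw [← h]
  exact_mod_cast eval_intCast_map (algebraMap ℤ ℚ) _ (n : ℤ)

/-- A rational function with integer values at all large integers is a polynomial. -/
theorem Polynomial.exists_eventually_eq_eval {P Q : ℚ[X]} (hQ : Q ≠ 0) {D : ℕ → ℕ}
    (h : ∀ᶠ n : ℕ in atTop, (D n : ℚ) * Q.eval (n : ℚ) = P.eval (n : ℚ)) :
    ∃ p : ℚ[X], ∀ᶠ n : ℕ in atTop, (D n : ℚ) = p.eval (n : ℚ) := by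
  -- Euclidean quotient: `D n - (P / Q)(n) = (P % Q)(n) / Q(n)` tends to `0`, while a fixed nonzero
  -- multiple `k` of it is an integer, so it is eventually `0`.
  refine ⟨P / Q, ?_⟩
  obtain ⟨k, hk, hkz⟩ := exists_natCast_mul_eval_int (P / Q)
  have hlim : Tendsto (fun n : ℕ => (k : ℚ) * ((P % Q).eval (n : ℚ) / Q.eval (n : ℚ))) atTop
      (nhds 0) := by
    have := ((P % Q).div_tendsto_atTop_zero_of_degree_lt Q (EuclideanDomain.mod_lt P hQ)).comp
      (tendsto_natCast_atTop_atTop (R := ℚ))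
    simpa using this.const_mul (k : ℚ)
  have hroot : ∀ᶠ n : ℕ in atTop, Q.eval (n : ℚ) ≠ 0 := by
    have := (Q.eventually_atTop_not_isRoot hQ)
    exact tendsto_natCast_atTop_atTop.eventually this
  filter_upwards [h, hroot, (hlim.eventually (Metric.ball_mem_nhds 0 one_pos))] with n hn hQn hlt
  obtain ⟨z, hz⟩ := hkz n
  have hPQ : P.eval (n : ℚ) = Q.eval (n : ℚ) * (P / Q).eval (n : ℚ) + (P % Q).eval (n : ℚ) := by
    rw [← eval_mul, ← eval_add, EuclideanDomain.div_add_mod]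
  have hdiv : (P % Q).eval (n : ℚ) / Q.eval (n : ℚ) = D n - (P / Q).eval (n : ℚ) := by
    rw [div_eq_iff hQn, sub_mul, hn, hPQ]
    ring
  have hint : (k : ℚ) * ((P % Q).eval (n : ℚ) / Q.eval (n : ℚ)) = ((k * D n - z : ℤ) : ℚ) := by
    rw [hdiv, mul_sub, hz]
    push_cast
    ring
  rw [hint, dist_zero_right, Int.norm_cast_rat, Int.norm_eq_abs] at hlt
  have hzero : k * D n - z = 0 := Int.abs_lt_one_iff.1 (by exact_mod_cast hlt)
  rw [hzero, Int.cast_zero, mul_eq_zero, hdiv] at hint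
  exact sub_eq_zero.1 (hint.resolve_left (by exact_mod_cast hk))

theorem Polynomial.degree_le_of_eval_le {p : ℚ[X]} {d c : ℕ}
    (h : ∀ᶠ n : ℕ in atTop, |p.eval (n : ℚ)| ≤ c * (n : ℚ) ^ d) : p.degree ≤ d := by
  by_contra! hd
  have h2 := (C (c : ℚ) * X ^ d).div_tendsto_atTop_zero_of_degree_lt p
    ((degree_C_mul_X_pow_le d _).trans_lt hd)
  have hp : p ≠ 0 := by rintro rfl; simp at hd
  have h3 := (h2.comp (tendsto_natCast_atTop_atTop (R := ℚ))).eventually (Metric.ball_mem_nhds 0 one_pos)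
  have h4 := tendsto_natCast_atTop_atTop.eventually (p.eventually_atTop_not_isRoot hp)
  obtain ⟨n, h, h6, h7⟩ := (h.and (h3.and h4)).exists
  have h8 : |(c * (n : ℚ) ^ d) / p.eval (n : ℚ)| < 1 := by
    rw [dist_zero_right, ← Rat.norm_cast_real, Real.norm_eq_abs] at h6
    simp only [Function.comp_apply, eval_mul, eval_C, eval_pow, eval_X] at h6
    exact_mod_cast h6
  rw [abs_div, div_lt_one (abs_pos.2 h7)] at h8
  exact absurd (h8.trans_le h) (not_lt.2 (le_abs_self _))

/-- Counting along a surjection, each element of the source weighted by the size of its fiber. -/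
theorem card_eq_sum_inv_card_fiber {X V : Type*} [Fintype X] [Fintype V] {π : X → V}
    (hπ : Function.Surjective π) (P : V → Prop) :
    (Nat.card {v // P v} : ℚ) =
      ∑ x : X, open Classical in if P (π x) then (Nat.card {y // π y = π x} : ℚ)⁻¹ else 0 := by
  classical
  rw [← Finset.sum_fiberwise (s := Finset.univ) (g := π), Nat.card_eq_fintype_card,
    Fintype.card_subtype, Finset.card_eq_sum_ones, Finset.sum_filter, Nat.cast_sum]
  refine Finset.sum_congr rfl fun v _ => ?_
  have : ∀ x ∈ Finset.univ.filter fun x => π x = v,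
      (if P (π x) then (Nat.card {y // π y = π x} : ℚ)⁻¹ else 0) =
        if P v then (Nat.card {y // π y = v} : ℚ)⁻¹ else 0 := by
    intro x hx
    rw [(Finset.mem_filter.1 hx).2]
  rw [Finset.sum_congr rfl this, Finset.sum_const, nsmul_eq_mul, ← Fintype.card_subtype,
    Nat.card_eq_fintype_card]
  obtain ⟨x, hx⟩ := hπ v
  have : Nonempty {y // π y = v} := ⟨⟨x, hx⟩⟩
  split_ifs
  · rw [mul_inv_cancel₀ (by exact_mod_cast Fintype.card_ne_zero), Nat.cast_one]
  · simp

/-! ### Vertex degrees in a stable `FI`-graph -/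

namespace FIGraph

variable (G : FIGraph.{u})

theorem transition_refl (n : ℕ) (v : (G.at_ n).V) :
    G.transition (Function.Embedding.refl (Fin n)) v = v :=
  congrArg (fun φ : G.at_ n ⟶ G.at_ n => FinSimpleGraph.onVertices φ v) (G.map_id (FI.mk n))

theorem transition_trans {l m n : ℕ} (f : Fin l ↪ Fin m) (g : Fin m ↪ Fin n) (v : (G.at_ l).V) :
    G.transition (f.trans g) v = G.transition g (G.transition f v) :=
  congrArg (fun φ : G.at_ l ⟶ G.at_ n => FinSimpleGraph.onVertices φ v)
    (G.map_comp (FI.ofEmbedding f) (FI.ofEmbedding g))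

theorem transition_adj {m n : ℕ} (f : Fin m ↪ Fin n) {v w : (G.at_ m).V}
    (h : (G.at_ m).graph.Adj v w) :
    (G.at_ n).graph.Adj (G.transition f v) (G.transition f w) :=
  SimpleGraph.Hom.map_adj (show (G.at_ m).graph →g (G.at_ n).graph from G.map (FI.ofEmbedding f)) h

variable {G} {d : ℕ}

theorem VertexStable.exists_transition_eq (hG : G.VertexStable d) {n : ℕ} (hn : d ≤ n)
    (v : (G.at_ n).V) : ∃ (w : (G.at_ d).V) (f : Fin d ↪ Fin n), G.transition f w = v := by
  induction n, hn using Nat.le_induction with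
  | base => exact ⟨v, _, G.transition_refl d v⟩
  | succ n hn ih =>
    obtain ⟨w, g, rfl⟩ := hG n hn v
    obtain ⟨w', f, rfl⟩ := ih w
    exact ⟨w', f.trans g, G.transition_trans f g w'⟩

variable (G d)

/-- For a relation on vertices that transition maps preserve, the number of injections `h` such that
`h_* w'` is related to `f_* w` is eventually a polynomial in `n`, independent of `f`. -/
theorem exists_polynomial_card_rel (P : ∀ n, (G.at_ n).V → (G.at_ n).V → Prop)
    (hP : ∀ n m (g : Fin n ↪ Fin m) v w, P n v w → P m (G.transition g v) (G.transition g w))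
    (w w' : (G.at_ d).V) :
    ∃ a : ℚ[X], ∀ᶠ n in atTop, ∀ f : Fin d ↪ Fin n,
      (Nat.card {h : Fin d ↪ Fin n // P n (G.transition f w) (G.transition h w')} : ℚ) =
        a.eval (n : ℚ) := by
  obtain ⟨T, hT⟩ := exists_eventually_iff_overlap_mem (d := d)
    (fun n f h => P n (G.transition f w) (G.transition h w')) fun n m f h g H => by
      rw [transition_trans, transition_trans]
      exact hP _ _ _ _ _ H
  obtain ⟨a, ha⟩ := exists_polynomial_card_overlap_mem T
  refine ⟨a, ?_⟩
  filter_upwards [hT, ha] with n h1 h2 f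
  rw [← h2 f, Nat.card_congr (Equiv.subtypeEquivRight fun h => h1 f h)]

variable {G d}

theorem VertexStable.exists_polynomial_degree (hG : G.VertexStable d) (w : (G.at_ d).V) :
    ∃ p : ℚ[X], ∀ᶠ n in atTop, ∀ f : Fin d ↪ Fin n,
      (Nat.card ((G.at_ n).graph.neighborSet (G.transition f w)) : ℚ) = p.eval (n : ℚ) := by
  classical
  choose a ha using fun w' => G.exists_polynomial_card_rel d (fun n => (G.at_ n).graph.Adj)
    (fun n m g v w h => G.transition_adj g h) w w'
  -- With equality as the relation, `∑ w₂, c w₁ w₂` gives the size of the fiber of `(w, f) ↦ f_* w`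
  -- through `(w₁, f)`.
  choose c hc using fun w₁ w₂ => G.exists_polynomial_card_rel d (fun n v w => w = v)
    (fun n m g v w h => h ▸ rfl) w₁ w₂
  have key : ∀ᶠ n : ℕ in atTop, (∀ w', (∑ w₂, c w' w₂).eval (n : ℚ) ≠ 0) ∧ ∀ f : Fin d ↪ Fin n,
      (Nat.card ((G.at_ n).graph.neighborSet (G.transition f w)) : ℚ) =
        ∑ w', (a w').eval (n : ℚ) / (∑ w₂, c w' w₂).eval (n : ℚ) := by
    filter_upwards [eventually_ge_atTop d, eventually_all.2 ha,
      eventually_all.2 fun w₁ => eventually_all.2 (hc w₁)] with n hn ha hc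
    let π : (G.at_ d).V × (Fin d ↪ Fin n) → (G.at_ n).V := fun x => G.transition x.2 x.1
    have hπ : Function.Surjective π := fun v => by
      obtain ⟨w, f, h⟩ := hG.exists_transition_eq hn v
      exact ⟨(w, f), h⟩
    have hfib : ∀ x, (Nat.card {y // π y = π x} : ℚ) = (∑ w₂, c x.1 w₂).eval (n : ℚ) := by
      rintro ⟨w₁, f⟩
      rw [eval_finsetSum, Nat.card_eq_fintype_card, Fintype.card_subtype, Finset.card_filter,
        Fintype.sum_prod_type, Nat.cast_sum]
      refine Finset.sum_congr rfl fun w₂ _ => ?_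
      rw [← hc w₁ w₂ f, Nat.card_eq_fintype_card, Fintype.card_subtype, Finset.card_filter]
    have hpos : ∀ x, (Nat.card {y // π y = π x} : ℚ) ≠ 0 := fun x => by
      have : Nonempty {y // π y = π x} := ⟨⟨x, rfl⟩⟩
      exact_mod_cast Nat.card_pos.ne'
    refine ⟨fun w' => hfib (w', Fin.castLEEmb hn) ▸ hpos _, fun f => ?_⟩
    have h1 := card_eq_sum_inv_card_fiber hπ fun v => (G.at_ n).graph.Adj (G.transition f w) v
    refine h1.trans ?_
    rw [Fintype.sum_prod_type]
    refine Finset.sum_congr rfl fun w' _ => ?_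
    simp only [hfib]
    rw [← Finset.sum_filter, Finset.sum_const, nsmul_eq_mul, ← ha w' f, Nat.card_eq_fintype_card,
      Fintype.card_subtype, div_eq_mul_inv]
  have hQ : ∏ w', ∑ w₂, c w' w₂ ≠ 0 := Finset.prod_ne_zero_iff.2 fun w' _ h => by
    obtain ⟨n, hn⟩ := key.exists
    exact hn.1 w' (by rw [h, eval_zero])
  obtain ⟨p, hp⟩ := exists_eventually_eq_eval hQ
    -- Numerator over the common denominator. By `key` the degree is eventually the same for every
    -- `f`, so the standard inclusion represents it; the value `0` for `n < d` is irrelevant.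
    (P := ∑ w', a w' * ∏ w₁ ∈ Finset.univ.erase w', ∑ w₂, c w₁ w₂)
    (D := fun n => if h : d ≤ n then
      Nat.card ((G.at_ n).graph.neighborSet (G.transition (Fin.castLEEmb h) w)) else 0) <| by
    filter_upwards [key, eventually_ge_atTop d] with n hn hdn
    rw [dif_pos hdn, hn.2, Finset.sum_mul, eval_finsetSum]
    refine Finset.sum_congr rfl fun w' _ => ?_
    rw [← Finset.mul_prod_erase _ _ (Finset.mem_univ w'), eval_mul, eval_mul, ← mul_assoc,
      div_mul_cancel₀ _ (hn.1 w')]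
  refine ⟨p, ?_⟩
  filter_upwards [hp, key, eventually_ge_atTop d] with n h1 h2 hn f
  rw [← h1, dif_pos hn, h2.2, h2.2]

theorem VertexStable.card_le (hG : G.VertexStable d) {n : ℕ} (hn : d ≤ n) :
    Fintype.card (G.at_ n).V ≤ Fintype.card (G.at_ d).V * n ^ d := by
  have hπ : Function.Surjective fun x : (G.at_ d).V × (Fin d ↪ Fin n) => G.transition x.2 x.1 :=
    fun v => by
      obtain ⟨w, f, h⟩ := hG.exists_transition_eq hn v
      exact ⟨(w, f), h⟩
  refine (Fintype.card_le_of_surjective _ hπ).trans ?_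
  rw [Fintype.card_prod, Fintype.card_embedding_eq, Fintype.card_fin, Fintype.card_fin]
  exact Nat.mul_le_mul_left _ (Nat.descFactorial_le_pow n d)

open Classical in
theorem VertexStable.exists_polynomials_degree (hG : G.VertexStable d) :
    ∃ p : (G.at_ d).V → ℚ[X], (∀ w, (p w).degree ≤ d) ∧
      ∀ᶠ n in atTop, ∀ w, ∀ f : Fin d ↪ Fin n,
        ((G.at_ n).graph.degree (G.transition f w) : ℚ) = (p w).eval (n : ℚ) := by
  choose p hp using hG.exists_polynomial_degree
  have key : ∀ᶠ n in atTop, ∀ w, ∀ f : Fin d ↪ Fin n,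
      ((G.at_ n).graph.degree (G.transition f w) : ℚ) = (p w).eval (n : ℚ) := by
    filter_upwards [eventually_all.2 hp] with n hn w f
    rw [← hn w f, ← SimpleGraph.card_neighborSet_eq_degree, Nat.card_eq_fintype_card]
  refine ⟨p, fun w => degree_le_of_eval_le (c := Fintype.card (G.at_ d).V) ?_, key⟩
  filter_upwards [key, eventually_ge_atTop d] with n hn hdn
  rw [← hn w (Fin.castLEEmb hdn), Nat.abs_cast]
  exact_mod_cast ((SimpleGraph.degree_lt_card_verts _).le.trans (hG.card_le hdn))

end FIGraph

theorem mainTheorem3 (G : FIGraph.{u}) (d : ℕ) (hG : G.VertexStable d) :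
    (∃ p : ℚ[X], p.degree ≤ (d : WithBot ℕ) ∧
      ∀ᶠ n : ℕ in atTop, ((G.at_ n).maxDeg : ℚ) = p.eval (n : ℚ)) ∧
    (∃ q : ℚ[X], q.degree ≤ (d : WithBot ℕ) ∧
      ∀ᶠ n : ℕ in atTop, ((G.at_ n).minDeg : ℚ) = q.eval (n : ℚ)) := by
  classical
  obtain ⟨p, hpd, hp⟩ := hG.exists_polynomials_degree
  rcases isEmpty_or_nonempty (G.at_ d).V with hV | hV
  · have hE : ∀ n, d ≤ n → IsEmpty (G.at_ n).V := fun n hn =>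
      ⟨fun v => hV.elim (hG.exists_transition_eq hn v).choose⟩
    refine ⟨⟨0, by simp, ?_⟩, ⟨0, by simp, ?_⟩⟩
    · filter_upwards [eventually_ge_atTop d] with n hn
      have := hE n hn
      simp [FinSimpleGraph.maxDeg]
    · filter_upwards [eventually_ge_atTop d] with n hn
      have := hE n hn
      simp [FinSimpleGraph.minDeg]
  · constructor
    · obtain ⟨w, hw⟩ := exists_eventually_eval_max p
      refine ⟨p w, hpd w, ?_⟩
      filter_upwards [hp, hw, eventually_ge_atTop d] with n hp hw hn
      have : Nonempty (G.at_ n).V := hV.map (G.transition (Fin.castLEEmb hn))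
      apply le_antisymm
      · obtain ⟨v, hv⟩ := (G.at_ n).graph.exists_maximal_degree_vertex
        obtain ⟨w', f, rfl⟩ := hG.exists_transition_eq hn v
        rw [FinSimpleGraph.maxDeg, hv, hp]
        exact hw w'
      · rw [← hp w (Fin.castLEEmb hn)]
        exact_mod_cast (G.at_ n).graph.degree_le_maxDegree _
    · obtain ⟨w, hw⟩ := exists_eventually_eval_min p
      refine ⟨p w, hpd w, ?_⟩
      filter_upwards [hp, hw, eventually_ge_atTop d] with n hp hw hn
      have : Nonempty (G.at_ n).V := hV.map (G.transition (Fin.castLEEmb hn))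
      apply le_antisymm
      · rw [← hp w (Fin.castLEEmb hn)]
        exact_mod_cast (G.at_ n).graph.minDegree_le_degree _
      · obtain ⟨v, hv⟩ := (G.at_ n).graph.exists_minimal_degree_vertex
        obtain ⟨w', f, rfl⟩ := hG.exists_transition_eq hn v
        rw [FinSimpleGraph.minDeg, hv, hp]
        exact hw w'
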